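/- Let $\mathcal{L}$ be a first-order language without relation symbols, and let $\mathcal{Q}$ be a quasivariety of $\mathcal{L}$-algebras, i.e. the class of all nonempty $\mathcal{L}$-algebras satisfying some set of quasi-identities $p_1=q_1\wedge\dots\wedge p_n=q_n\to p=q$ ($n\ge 0$). A relative congruence of an $\mathcal{L}$-algebra $\mathbf{A}$ is a congruence $\theta$ of $\mathbf{A}$ with $\mathbf{A}/\theta\in\mathcal{Q}$; write $\mathrm{Con}_{\mathcal{Q}}(\mathbf{A})$ for the set of these. For $\mathbf{A}\in\mathcal{Q}$ and $a,b\in A$, let $\theta^{\mathbf{A}}_{\mathcal{Q}}(a,b)$ be the least relative congruence of $\mathbf{A}$ containing $(a,b)$. A first-order $\mathcal{L}$-formula $\varphi(x,y,z,w)$ defines relative principal congruences in $\mathcal{Q}$ if $\theta^{\mathbf{A}}_{\mathcal{Q}}(a,b)=\{(c,d)\in A^2:\mathbf{A}\vDash\varphi(a,b,c,d)\}$ for all $\mathbf{A}\in\mathcal{Q}$ and $a,b\in A$. Suppose that some first-order $\mathcal{L}$-formula defines relative principal congruences in $\mathcal{Q}$. Then the following are equivalent: 1. There is a formula of the form $\forall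 x_1\dots\forall x_n\,\psi$, with $n\ge 0$ and $\psi$ a quantifier-free $\mathcal{L}$-formula, which defines relative principal congruences in $\mathcal{Q}$. 2. There is a finite nonempty disjunction of finite nonempty conjunctions of atomic $\mathcal{L}$-formulas which defines relative principal congruences in $\mathcal{Q}$. 3. $\mathcal{Q}$ has the relative congruence extension property: for every $\mathbf{B}\in\mathcal{Q}$, every subalgebra $\mathbf{A}$ of $\mathbf{B}$ and every $\theta\in\mathrm{Con}_{\mathcal{Q}}(\mathbf{A})$ there is $\delta\in\mathrm{Con}_{\mathcal{Q}}(\mathbf{B})$ with $\theta=\delta\cap A^2$. -/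

import Mathlib

open FirstOrder FirstOrder.Language CategoryTheory

universe u v w

/-- A quasi-identity `p₁ = q₁ ∧ … ∧ pₙ = qₙ → p = q` with `n ≥ 0`, in variables indexed by `ℕ`. -/
structure QuasiIdentity (L : FirstOrder.Language.{u, v}) where
  /-- the equations `pᵢ = qᵢ` -/
  premises : List (L.Term ℕ × L.Term ℕ)
  /-- the equation `p = q` -/
  conclusion : L.Term ℕ × L.Term ℕ

/-- The quasi-identity holds in `A` under every assignment of the variables. -/
def QuasiIdentity.Holds {L : FirstOrder.Language.{u, v}} (e : QuasiIdentity L)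
    (A : Type w) [L.Structure A] : Prop :=
  ∀ x : ℕ → A, (∀ p ∈ e.premises, p.1.realize x = p.2.realize x) →
    e.conclusion.1.realize x = e.conclusion.2.realize x

/-- A class of algebras is a quasivariety if it consists of all (nonempty) algebras
that satisfy some set of quasi-identities. -/
def IsQuasivariety {L : FirstOrder.Language.{u, v}} (Q : Set (Bundled.{w} L.Structure)) : Prop :=
  ∃ E : Set (QuasiIdentity L), ∀ A : Bundled.{w} L.Structure,
    A ∈ Q ↔ Nonempty A ∧ ∀ e ∈ E, e.Holds A

/-- A congruence of an algebra: an equivalence relation compatible with all basic operations. -/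
structure AlgCongruence (L : FirstOrder.Language.{u, v}) (A : Type w) [L.Structure A] where
  /-- the underlying equivalence relation -/
  rel : Setoid A
  compatible : ∀ {n : ℕ} (f : L.Functions n) (x y : Fin n → A),
    (∀ i, rel (x i) (y i)) → rel (Structure.funMap f x) (Structure.funMap f y)

namespace AlgCongruence

variable {L : FirstOrder.Language.{u, v}} [L.IsAlgebraic] {A : Type w} [L.Structure A]

/-- A congruence makes `A` a prestructure in the sense of Mathlib's quotient structures. -/
@[reducible]
def prestructure (θ : AlgCongruence L A) : L.Prestructure θ.rel where
  toStructure := inferInstance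
  fun_equiv := fun {_} {f} x y h => θ.compatible f x y h
  rel_equiv := fun {_} {r} => isEmptyElim r

/-- The quotient algebra `A / θ`. -/
def quotient (θ : AlgCongruence L A) : Bundled.{w} L.Structure :=
  ⟨Quotient θ.rel, @quotientStructure L A θ.rel θ.prestructure⟩

end AlgCongruence

/-- `Con_Q(A)`: the congruences `θ` of `A` with `A / θ ∈ Q`. -/
def relCon {L : FirstOrder.Language.{u, v}} [L.IsAlgebraic] (Q : Set (Bundled.{w} L.Structure))
    (A : Type w) [L.Structure A] : Set (AlgCongruence L A) :=
  {θ | θ.quotient ∈ Q}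

/-- `θ_Q^A(a, b)`: the relative principal congruence generated by `(a, b)`, as a set of pairs;
the intersection of all relative congruences that contain `(a, b)`. -/
def relPrincipalCon {L : FirstOrder.Language.{u, v}} [L.IsAlgebraic] (Q : Set (Bundled.{w} L.Structure))
    (A : Type w) [L.Structure A] (a b : A) : Set (A × A) :=
  {p | ∀ θ ∈ relCon Q A, θ.rel a b → θ.rel p.1 p.2}

/-- The formula `φ(x, y, z, w)` defines relative principal congruences in `Q`:
`θ_Q^A(a, b) = {(c, d) : A ⊨ φ(a, b, c, d)}` for all `A ∈ Q` and `a, b ∈ A`. -/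
def DefinesRelPrincipalCon {L : FirstOrder.Language.{u, v}} [L.IsAlgebraic]
    (Q : Set (Bundled.{w} L.Structure)) (φ : L.Formula (Fin 4)) : Prop :=
  ∀ A ∈ Q, ∀ a b : A, relPrincipalCon Q A a b = {p | φ.Realize ![a, b, p.1, p.2]}

/-- The relative congruence extension property: for all `A ≤ B ∈ Q`, every relative congruence
of `A` is the restriction to `A` of a relative congruence of `B`. -/
def HasRelCongruenceExtension {L : FirstOrder.Language.{u, v}} [L.IsAlgebraic]
    (Q : Set (Bundled.{w} L.Structure)) : Prop :=
  ∀ B ∈ Q, ∀ A : L.Substructure B, Nonempty A → ∀ θ ∈ relCon Q A,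
    ∃ δ ∈ relCon Q B, ∀ x y : A, θ.rel x y ↔ δ.rel (x : B) (y : B)

/-- `[⋀ S]`: the conjunctions `φ₁ ∧ … ∧ φₙ` with `n ≥ 1` and all `φᵢ ∈ S`. -/
inductive FinConj {L : FirstOrder.Language.{u, v}} {α : Type} (S : Set (L.Formula α)) : Set (L.Formula α)
  | of (φ : L.Formula α) : φ ∈ S → FinConj S φ
  | inf (φ ψ : L.Formula α) : FinConj S φ → FinConj S ψ → FinConj S (φ ⊓ ψ)

/-- `[⋁ S]`: the disjunctions `φ₁ ∨ … ∨ φₙ` with `n ≥ 1` and all `φᵢ ∈ S`. -/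
inductive FinDisj {L : FirstOrder.Language.{u, v}} {α : Type} (S : Set (L.Formula α)) : Set (L.Formula α)
  | of (φ : L.Formula α) : φ ∈ S → FinDisj S φ
  | sup (φ ψ : L.Formula α) : FinDisj S φ → FinDisj S ψ → FinDisj S (φ ⊔ ψ)

/-- `At(L)`: the atomic formulas in the given variables. -/
def atomicFormulas (L : FirstOrder.Language.{u, v}) (α : Type) : Set (L.Formula α) :=
  {φ | BoundedFormula.IsAtomic φ}

/-- `[∀ Op(L)]`: the formulas `∀ x₁ … ∀ xₙ φ` with `n ≥ 0` and `φ` quantifier-free. -/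
def universalOpenFormulas (L : FirstOrder.Language.{u, v}) (α : Type) : Set (L.Formula α) :=
  {φ | BoundedFormula.IsUniversal φ}

/-! A universal formula is inherited by subalgebras. Given `θ` on `A ≤ B`, Zorn's lemma yields a
relative congruence `δ` of `B` maximal among those restricting into `θ`. For `(a, b) ∈ θ`, a
universal `φ` for `B / δ` descends to the image of `A`, so adjoining `(a, b)` to `δ` still restricts
into `θ`; maximality then puts `(a, b)` in `δ` (`hasRelCongruenceExtension_of_isUniversal`).
Conversely, under the extension property, `(c, d)` lies in the principal congruence of `(a, b)`
already inside the subalgebra these four elements generate, and homomorphisms out of it preserve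
this. So the equations true of a tuple satisfying `φ` imply `φ` throughout the quasivariety.
Compactness, by ultraproducts, is used twice: to cut these equations to a finite conjunction, then
to cover `φ` by finitely many conjunctions. Quantifier-free formulas are universal, which closes the
circle. -/

/-! ### Congruences, unions of chains, and quotients -/

namespace AlgCongruence

variable {L : FirstOrder.Language.{u, v}} {A B : Type w} [L.Structure A] [L.Structure B]

/-- The congruence that relates only equal elements. -/
def identity (L : FirstOrder.Language.{u, v}) (A : Type w) [L.Structure A] :
    AlgCongruence L A where
  rel := ⊥
  compatible f x y h := by
    have : x = y := funext h
    exact congrArg _ this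

/-- The preimage of a congruence under a homomorphism. -/
def comap (f : A →[L] B) (θ : AlgCongruence L B) : AlgCongruence L A where
  rel := θ.rel.comap f
  compatible g x y h := by
    change θ.rel _ _
    rw [f.map_fun, f.map_fun]
    exact θ.compatible g _ _ h

/-- The intersection of a set of congruences. -/
def inter (S : Set (AlgCongruence L A)) : AlgCongruence L A where
  rel :=
    { r := fun x y => ∀ θ ∈ S, θ.rel x y
      iseqv := ⟨fun _ θ _ => θ.rel.refl _, fun h θ hθ => θ.rel.symm (h θ hθ),
        fun h k θ hθ => θ.rel.trans (h θ hθ) (k θ hθ)⟩ }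
  compatible f _ _ h θ hθ := θ.compatible f _ _ fun i => h i θ hθ

/-- Finitely many pairs in the union of a nonempty chain of congruences lie in a single member. -/
theorem exists_mem_of_isChain {c : Set (AlgCongruence L A)} (hne : c.Nonempty)
    (hc : IsChain (fun θ η => θ.rel ≤ η.rel) c) {ι : Type*} (s : Finset ι) (x y : ι → A)
    (h : ∀ i ∈ s, ∃ θ ∈ c, θ.rel (x i) (y i)) : ∃ θ ∈ c, ∀ i ∈ s, θ.rel (x i) (y i) := by
  classical
  induction s using Finset.induction_on with
  | empty => exact hne.imp fun θ hθ => ⟨hθ, by simp⟩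
  | insert i s _ ih =>
    obtain ⟨θ, hθ, h₁⟩ := ih fun j hj => h j (Finset.mem_insert_of_mem hj)
    obtain ⟨η, hη, h₂⟩ := h i (Finset.mem_insert_self i s)
    have : Std.Refl (fun θ η : AlgCongruence L A => θ.rel ≤ η.rel) := ⟨fun _ => le_rfl⟩
    obtain hle | hle := hc.total hθ hη
    · refine ⟨η, hη, fun j hj => ?_⟩
      obtain rfl | hj := Finset.mem_insert.1 hj
      exacts [h₂, hle (h₁ j hj)]
    · refine ⟨θ, hθ, fun j hj => ?_⟩
      obtain rfl | hj := Finset.mem_insert.1 hj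
      exacts [hle h₂, h₁ j hj]

/-- The union of a nonempty chain of congruences. -/
def chainUnion (c : Set (AlgCongruence L A)) (hne : c.Nonempty)
    (hc : IsChain (fun θ η => θ.rel ≤ η.rel) c) : AlgCongruence L A where
  rel :=
    { r := fun x y => ∃ θ ∈ c, θ.rel x y
      iseqv := by
        refine ⟨fun x => hne.imp fun θ hθ => ⟨hθ, θ.rel.refl x⟩,
          fun ⟨θ, hθ, h⟩ => ⟨θ, hθ, θ.rel.symm h⟩, fun {x y z} h k => ?_⟩
        obtain ⟨θ, hθ, h'⟩ := exists_mem_of_isChain hne hc Finset.univ ![x, y] ![y, z]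
          (by simpa [Fin.forall_fin_two] using ⟨h, k⟩)
        exact ⟨θ, hθ, θ.rel.trans (h' 0 (Finset.mem_univ _)) (h' 1 (Finset.mem_univ _))⟩ }
  compatible f x y h := by
    obtain ⟨θ, hθ, h'⟩ := exists_mem_of_isChain hne hc Finset.univ x y fun i _ => h i
    exact ⟨θ, hθ, θ.compatible f x y fun i => h' i (Finset.mem_univ i)⟩

variable [L.IsAlgebraic]

theorem funMap_quotient_mk (θ : AlgCongruence L A) {n : ℕ} (f : L.Functions n) (x : Fin n → A) :
    (Structure.funMap f (fun i => (Quotient.mk θ.rel (x i) : θ.quotient)) : θ.quotient) =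
      Quotient.mk θ.rel (Structure.funMap f x) :=
  @funMap_quotient_mk' L A θ.rel θ.prestructure n f x

/-- The projection onto the quotient algebra. -/
def proj (θ : AlgCongruence L A) : A →[L] θ.quotient where
  toFun := Quotient.mk θ.rel
  map_fun' f x := (θ.funMap_quotient_mk f x).symm
  map_rel' r := isEmptyElim r

theorem proj_eq_proj {θ : AlgCongruence L A} {x y : A} : θ.proj x = θ.proj y ↔ θ.rel x y :=
  Quotient.eq (r := θ.rel)

theorem proj_surjective (θ : AlgCongruence L A) : Function.Surjective θ.proj :=
  Quotient.mk_surjective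

/-- The congruence `θ / η` of the quotient `A / η`, where `η ≤ θ`. -/
noncomputable def ofLE (η θ : AlgCongruence L A) (h : η.rel ≤ θ.rel) : AlgCongruence L η.quotient where
  rel := θ.rel.comap (Function.surjInv η.proj_surjective)
  compatible f x y hxy := by
    -- The section of the projection commutes with operations only up to `η`, and `η ≤ θ` absorbs
    -- the error.
    have key : ∀ z : Fin _ → η.quotient,
        θ.rel (Function.surjInv η.proj_surjective (Structure.funMap f z))
          (Structure.funMap f fun i => Function.surjInv η.proj_surjective (z i)) := fun z => by
      apply h
      rw [← proj_eq_proj, Function.surjInv_eq η.proj_surjective, η.proj.map_fun]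
      exact congrArg _ (funext fun i => (Function.surjInv_eq η.proj_surjective (z i)).symm)
    exact θ.rel.trans (key x) (θ.rel.trans (θ.compatible f _ _ hxy) (θ.rel.symm (key y)))

theorem ofLE_rel_proj {η θ : AlgCongruence L A} (h : η.rel ≤ θ.rel) (x y : A) :
    (η.ofLE θ h).rel (η.proj x) (η.proj y) ↔ θ.rel x y := by
  have key : ∀ z : A, θ.rel (Function.surjInv η.proj_surjective (η.proj z)) z := fun z =>
    h (proj_eq_proj.1 (Function.surjInv_eq η.proj_surjective (η.proj z)))
  exact ⟨fun k => θ.rel.trans (θ.rel.symm (key x)) (θ.rel.trans k (key y)),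
    fun k => θ.rel.trans (key x) (θ.rel.trans k (θ.rel.symm (key y)))⟩

/-- The embedding `A / f⁻¹(θ) ↪ B / θ` induced by a homomorphism `f : A → B`. -/
def quotientComapEmbedding (f : A →[L] B) (θ : AlgCongruence L B) :
    (θ.comap f).quotient ↪[L] θ.quotient where
  toFun := Quotient.map f fun _ _ h => h
  inj' := by
    rintro ⟨x⟩ ⟨y⟩ h
    exact Quotient.sound (s := (θ.comap f).rel) (Quotient.exact (s := θ.rel) h)
  map_fun' {n} g x := by
    obtain ⟨x, rfl⟩ : ∃ x' : Fin n → A, x = fun i => (θ.comap f).proj (x' i) :=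
      ⟨fun i => Function.surjInv (θ.comap f).proj_surjective (x i),
        funext fun i => (Function.surjInv_eq (θ.comap f).proj_surjective (x i)).symm⟩
    have h := ((θ.comap f).proj.map_fun g x).symm
    refine (congrArg (Quotient.map f fun _ _ h => h) h).trans ?_
    change θ.proj (f (Structure.funMap g x)) = _
    rw [f.map_fun, θ.proj.map_fun]
    rfl
  map_rel' r := isEmptyElim r

end AlgCongruence

/-- The quasi-identity holds in `A` modulo the congruence `θ`. -/
def QuasiIdentity.HoldsMod {L : FirstOrder.Language.{u, v}} (e : QuasiIdentity L) {A : Type w}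
    [L.Structure A] (θ : AlgCongruence L A) : Prop :=
  ∀ x : ℕ → A, (∀ p ∈ e.premises, θ.rel (p.1.realize x) (p.2.realize x)) →
    θ.rel (e.conclusion.1.realize x) (e.conclusion.2.realize x)

/-! ### Relative congruences, and the extension property from a universal formula -/

section RelCon

variable {L : FirstOrder.Language.{u, v}} [L.IsAlgebraic] {Q : Set (Bundled.{w} L.Structure)}
  {A B : Type w} [L.Structure A] [L.Structure B]

theorem QuasiIdentity.holds_quotient_iff (e : QuasiIdentity L) (θ : AlgCongruence L A) :
    e.Holds θ.quotient ↔ e.HoldsMod θ := by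
  have key : ∀ (x : ℕ → A) (p : L.Term ℕ × L.Term ℕ),
      p.1.realize (θ.proj ∘ x) = p.2.realize (θ.proj ∘ x) ↔
        θ.rel (p.1.realize x) (p.2.realize x) := fun x p => by
    rw [HomClass.realize_term, HomClass.realize_term, AlgCongruence.proj_eq_proj]
  constructor
  · intro h x hx
    exact (key x _).1 (h _ fun p hp => (key x p).2 (hx p hp))
  · intro h x
    obtain ⟨x, rfl⟩ := θ.proj_surjective.comp_left x
    intro hx
    exact (key x _).2 (h x fun p hp => (key x p).1 (hx p hp))

/-- Replaces computations in the quotient by closure conditions on pairs of `A`, from which the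
closure properties of relative congruences are read off. -/
theorem mem_relCon_iff {E : Set (QuasiIdentity L)}
    (hE : ∀ A : Bundled.{w} L.Structure, A ∈ Q ↔ Nonempty A ∧ ∀ e ∈ E, e.Holds A)
    (θ : AlgCongruence L A) : θ ∈ relCon Q A ↔ Nonempty A ∧ ∀ e ∈ E, e.HoldsMod θ := by
  refine (hE θ.quotient).trans (and_congr ?_ ?_)
  · exact ⟨fun ⟨x⟩ => ⟨(θ.proj_surjective x).choose⟩, fun ⟨x⟩ => ⟨θ.proj x⟩⟩
  · exact forall₂_congr fun e _ => e.holds_quotient_iff θ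

theorem comap_mem_relCon (hQ : IsQuasivariety Q) [Nonempty A] (f : A →[L] B)
    {θ : AlgCongruence L B} (hθ : θ ∈ relCon Q B) : θ.comap f ∈ relCon Q A := by
  obtain ⟨E, hE⟩ := hQ
  rw [mem_relCon_iff hE] at hθ ⊢
  refine ⟨inferInstance, fun e he x hx => ?_⟩
  have := hθ.2 e he (f ∘ x) fun p hp => by
    rw [HomClass.realize_term, HomClass.realize_term]
    exact hx p hp
  rw [HomClass.realize_term, HomClass.realize_term] at this
  exact this

theorem inter_mem_relCon (hQ : IsQuasivariety Q) [Nonempty A] {S : Set (AlgCongruence L A)}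
    (hS : S ⊆ relCon Q A) : AlgCongruence.inter S ∈ relCon Q A := by
  obtain ⟨E, hE⟩ := hQ
  rw [mem_relCon_iff hE]
  exact ⟨inferInstance, fun e he x hx θ hθ =>
    ((mem_relCon_iff hE θ).1 (hS hθ)).2 e he x fun p hp => hx p hp θ hθ⟩

theorem identity_mem_relCon (hQ : IsQuasivariety Q) {A : Bundled.{w} L.Structure} (hA : A ∈ Q) :
    AlgCongruence.identity L A ∈ relCon Q A := by
  obtain ⟨E, hE⟩ := hQ
  rw [mem_relCon_iff hE]
  exact (hE A).1 hA

/-- A quasi-identity has finitely many premises, so one member of the chain already contains them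
all. -/
theorem chainUnion_mem_relCon (hQ : IsQuasivariety Q) [Nonempty A] {c : Set (AlgCongruence L A)}
    (hne : c.Nonempty) (hc : IsChain (fun θ η => θ.rel ≤ η.rel) c) (hS : c ⊆ relCon Q A) :
    AlgCongruence.chainUnion c hne hc ∈ relCon Q A := by
  classical
  obtain ⟨E, hE⟩ := hQ
  rw [mem_relCon_iff hE]
  refine ⟨inferInstance, fun e he x hx => ?_⟩
  obtain ⟨θ, hθ, h⟩ := AlgCongruence.exists_mem_of_isChain hne hc (Finset.univ)
    (fun i : Fin e.premises.length => (e.premises.get i).1.realize x)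
    (fun i => (e.premises.get i).2.realize x) fun i _ => hx _ (List.get_mem _ i)
  refine ⟨θ, hθ, ((mem_relCon_iff hE θ).1 (hS hθ)).2 e he x fun p hp => ?_⟩
  obtain ⟨i, rfl⟩ := List.mem_iff_get.1 hp
  exact h i (Finset.mem_univ i)

theorem ofLE_mem_relCon (hQ : IsQuasivariety Q) {η θ : AlgCongruence L A} (h : η.rel ≤ θ.rel)
    (hθ : θ ∈ relCon Q A) : η.ofLE θ h ∈ relCon Q η.quotient := by
  obtain ⟨E, hE⟩ := hQ
  rw [mem_relCon_iff hE] at hθ ⊢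
  obtain ⟨⟨a⟩, hθ⟩ := hθ
  refine ⟨⟨η.proj a⟩, fun e he x => ?_⟩
  obtain ⟨x, rfl⟩ := η.proj_surjective.comp_left x
  simp only [HomClass.realize_term, AlgCongruence.ofLE_rel_proj]
  exact hθ e he x

theorem relPrincipalCon_map (hQ : IsQuasivariety Q) [Nonempty A] (f : A →[L] B) {a b c d : A}
    (h : (c, d) ∈ relPrincipalCon Q A a b) : (f c, f d) ∈ relPrincipalCon Q B (f a) (f b) :=
  fun θ hθ hab => h (θ.comap f) (comap_mem_relCon hQ f hθ) hab

theorem DefinesRelPrincipalCon.realize_iff {φ : L.Formula (Fin 4)}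
    (hφ : DefinesRelPrincipalCon Q φ) {A : Bundled.{w} L.Structure} (hA : A ∈ Q) (v : Fin 4 → A) :
    φ.Realize v ↔ (v 2, v 3) ∈ relPrincipalCon Q A (v 0) (v 1) := by
  rw [hφ A hA]
  have : v = ![v 0, v 1, v 2, v 3] := by ext i; fin_cases i <;> rfl
  conv_lhs => rw [this]
  rfl

theorem hasRelCongruenceExtension_of_isUniversal (hQ : IsQuasivariety Q) {φ : L.Formula (Fin 4)}
    (hu : BoundedFormula.IsUniversal φ) (hφ : DefinesRelPrincipalCon Q φ) :
    HasRelCongruenceExtension Q := by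
  intro B hB A hne θ hθ
  have : Nonempty B := hne.map (↑)
  let Z : Set (AlgCongruence L B) :=
    {δ | δ ∈ relCon Q B ∧ ∀ x y : A, δ.rel (x : B) (y : B) → θ.rel x y}
  obtain ⟨⟨δ, hδ, hδθ⟩, hmax⟩ := exists_maximal_of_chains_bounded
    (r := fun δ η : Z => δ.1.rel ≤ η.1.rel)
    (fun c hc => by
      obtain rfl | hcne := c.eq_empty_or_nonempty
      · exact ⟨⟨_, identity_mem_relCon hQ hB, fun x y h => by
          obtain rfl : x = y := Subtype.ext h
          exact θ.rel.refl x⟩, by simp⟩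
      · have hc' : IsChain (fun δ η : AlgCongruence L B => δ.rel ≤ η.rel) (Subtype.val '' c) := by
          rintro _ ⟨δ, hδ, rfl⟩ _ ⟨η, hη, rfl⟩ hne
          exact hc hδ hη fun h => hne (congrArg _ h)
        refine ⟨⟨AlgCongruence.chainUnion _ (hcne.image _) hc', chainUnion_mem_relCon hQ _ _ ?_,
          ?_⟩, fun δ hδ x y h => ⟨δ, ⟨δ, hδ, rfl⟩, h⟩⟩
        · rintro _ ⟨δ, -, rfl⟩
          exact δ.2.1
        · rintro x y ⟨_, ⟨δ, -, rfl⟩, h⟩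
          exact δ.2.2 x y h)
    (fun h k => h.trans k)
  refine ⟨δ, hδ, fun a b => ⟨fun hab => ?_, hδθ a b⟩⟩
  -- The intersection of `S` is the least relative congruence above `δ` containing `(a, b)`; once it
  -- is shown to restrict into `θ`, maximality forces it below `δ`.
  let S : Set (AlgCongruence L B) := {γ | γ ∈ relCon Q B ∧ δ.rel ≤ γ.rel ∧ γ.rel (a : B) (b : B)}
  have hle : δ.rel ≤ (AlgCongruence.inter S).rel := fun x y h γ hγ => hγ.2.1 h
  refine hmax ⟨AlgCongruence.inter S, inter_mem_relCon hQ fun γ hγ => hγ.1, fun c d hcd => ?_⟩ hle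
    fun γ hγ => hγ.2.2
  let ι := A.subtype.toHom
  let π := (δ.comap ι).proj
  have hB' : φ.Realize ![δ.proj a, δ.proj b, δ.proj c, δ.proj d] := by
    rw [hφ.realize_iff hδ]
    intro η hη hab'
    have : Nonempty δ.quotient := ⟨δ.proj a⟩
    exact hcd (η.comap δ.proj) ⟨comap_mem_relCon hQ _ hη, fun x y h => by
      change η.rel _ _
      rw [AlgCongruence.proj_eq_proj.2 h], hab'⟩
  -- Universality is used only here: `φ` passes down the embedding of `A / (δ ∩ A²)` into `B / δ`.
  have hA' : φ.Realize ![π a, π b, π c, π d] := by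
    refine BoundedFormula.IsUniversal.realize_embedding hu (δ.quotientComapEmbedding ι) ?_
    have hv : δ.quotientComapEmbedding ι ∘ ![π a, π b, π c, π d] =
        ![δ.proj a, δ.proj b, δ.proj c, δ.proj d] := by
      ext i
      fin_cases i <;> rfl
    rw [hv, Subsingleton.elim (δ.quotientComapEmbedding ι ∘ default) default]
    exact hB'
  rw [hφ.realize_iff (comap_mem_relCon hQ ι hδ)] at hA'
  have hle' : (δ.comap ι).rel ≤ θ.rel := fun x y h => hδθ x y h
  exact (AlgCongruence.ofLE_rel_proj hle' c d).1 (hA' _ (ofLE_mem_relCon hQ hle' hθ)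
    ((AlgCongruence.ofLE_rel_proj hle' a b).2 hab))

end RelCon

/-! ### Finite conjunctions and disjunctions -/

section FiniteCombinations

variable {L : FirstOrder.Language.{u, v}} {α : Type} {S : Set (L.Formula α)}

theorem FinConj.isQF (hS : ∀ φ ∈ S, BoundedFormula.IsQF φ) {χ : L.Formula α} (h : FinConj S χ) :
    BoundedFormula.IsQF χ := by
  induction h with
  | of φ hφ => exact hS φ hφ
  | inf φ ψ _ _ h₁ h₂ => exact h₁.inf h₂

theorem FinDisj.isQF (hS : ∀ φ ∈ S, BoundedFormula.IsQF φ) {χ : L.Formula α} (h : FinDisj S χ) :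
    BoundedFormula.IsQF χ := by
  induction h with
  | of φ hφ => exact hS φ hφ
  | sup φ ψ _ _ h₁ h₂ => exact h₁.sup h₂

theorem FinConj.mono {T : Set (L.Formula α)} (hST : S ⊆ T) {χ : L.Formula α} (h : FinConj S χ) :
    FinConj T χ := by
  induction h with
  | of φ hφ => exact .of φ (hST hφ)
  | inf φ ψ _ _ h₁ h₂ => exact .inf φ ψ h₁ h₂

theorem FinDisj.mono {T : Set (L.Formula α)} (hST : S ⊆ T) {χ : L.Formula α} (h : FinDisj S χ) :
    FinDisj T χ := by
  induction h with
  | of φ hφ => exact .of φ (hST hφ)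
  | sup φ ψ _ _ h₁ h₂ => exact .sup φ ψ h₁ h₂

theorem FinConj.realize {χ : L.Formula α} (h : FinConj S χ) {M : Type w} [L.Structure M]
    {x : α → M} (hx : ∀ ψ ∈ S, ψ.Realize x) : χ.Realize x := by
  induction h with
  | of φ hφ => exact hx φ hφ
  | inf φ ψ _ _ h₁ h₂ => exact Formula.realize_inf.2 ⟨h₁, h₂⟩

theorem FinDisj.exists_realize {χ : L.Formula α} (h : FinDisj S χ) {M : Type w} [L.Structure M]
    {x : α → M} (hx : χ.Realize x) : ∃ ψ ∈ S, ψ.Realize x := by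
  induction h with
  | of φ hφ => exact ⟨φ, hφ, hx⟩
  | sup φ ψ _ _ h₁ h₂ => exact (Formula.realize_sup.1 hx).elim h₁ h₂

theorem FinConj.exists_realize_imp (hS : S.Nonempty) (F : Finset (L.Formula α))
    (hF : (F : Set (L.Formula α)) ⊆ S) :
    ∃ χ, FinConj S χ ∧ ∀ (M : Type w) [L.Structure M] (x : α → M), χ.Realize x →
      ∀ ψ ∈ F, ψ.Realize x := by
  classical
  induction F using Finset.induction_on with
  | empty => exact hS.imp fun φ hφ => ⟨.of φ hφ, by simp⟩
  | insert φ F _ ih =>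
    obtain ⟨χ, hχ, h⟩ := ih fun ψ hψ => hF (Finset.mem_insert_of_mem hψ)
    refine ⟨φ ⊓ χ, .inf _ _ (.of φ (hF (Finset.mem_insert_self φ F))) hχ, fun M _ x hx ψ hψ => ?_⟩
    rw [Formula.realize_inf] at hx
    obtain rfl | hψ := Finset.mem_insert.1 hψ
    exacts [hx.1, h M x hx.2 ψ hψ]

theorem FinDisj.exists_realize_of_mem (hS : S.Nonempty) (F : Finset (L.Formula α))
    (hF : (F : Set (L.Formula α)) ⊆ S) :
    ∃ χ, FinDisj S χ ∧ ∀ (M : Type w) [L.Structure M] (x : α → M),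
      ∀ ψ ∈ F, ψ.Realize x → χ.Realize x := by
  classical
  induction F using Finset.induction_on with
  | empty => exact hS.imp fun φ hφ => ⟨.of φ hφ, by simp⟩
  | insert φ F _ ih =>
    obtain ⟨χ, hχ, h⟩ := ih fun ψ hψ => hF (Finset.mem_insert_of_mem hψ)
    refine ⟨φ ⊔ χ, .sup _ _ (.of φ (hF (Finset.mem_insert_self φ F))) hχ, fun M _ x ψ hψ hx => ?_⟩
    rw [Formula.realize_sup]
    obtain rfl | hψ := Finset.mem_insert.1 hψ
    exacts [.inl hx, .inr (h M x ψ hψ hx)]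

end FiniteCombinations

/-! ### Compactness by ultraproducts -/

section Compactness

variable {L : FirstOrder.Language.{u, v}}

theorem QuasiIdentity.Holds.ultraproduct {e : QuasiIdentity L} {ι : Type*} {M : ι → Type w}
    [∀ i, L.Structure (M i)] (h : ∀ i, e.Holds (M i)) (U : Ultrafilter ι) :
    e.Holds ((U : Filter ι).Product M) := by
  intro x
  obtain ⟨x, rfl⟩ : ∃ x' : ℕ → ∀ i, M i, x = fun n => (x' n : (U : Filter ι).Product M) :=
    ⟨fun n => (x n).out, funext fun n => (Quotient.out_eq (x n)).symm⟩
  have key : ∀ p : L.Term ℕ × L.Term ℕ,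
      (p.1.realize fun n => (x n : (U : Filter ι).Product M)) =
        (p.2.realize fun n => (x n : (U : Filter ι).Product M)) ↔
      ∀ᶠ i in U, (p.1.realize fun n => x n i) = p.2.realize fun n => x n i := fun p => by
    rw [Ultraproduct.term_realize_cast, Ultraproduct.term_realize_cast]
    exact Quotient.eq''
  intro hx
  refine (key _).2 ?_
  -- Finiteness of the premises lets them hold simultaneously on one set of the ultrafilter.
  have hx' : ∀ᶠ i in U, ∀ p ∈ {p | p ∈ e.premises},
      (p.1.realize fun n => x n i) = p.2.realize fun n => x n i :=
    (Filter.eventually_all_finite (List.finite_toSet e.premises)).2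
      fun p hp => (key p).1 (hx p hp)
  exact hx'.mono fun i hi => h i _ hi

/-- Compactness relative to a quasivariety. -/
theorem IsQuasivariety.exists_realize {Q : Set (Bundled.{max u v w} L.Structure)}
    (hQ : IsQuasivariety Q) {α : Type} (Γ : Set (L.Formula α))
    (h : ∀ F : Finset (L.Formula α), (F : Set (L.Formula α)) ⊆ Γ →
      ∃ A ∈ Q, ∃ x : α → A, ∀ ψ ∈ F, ψ.Realize x) :
    ∃ A ∈ Q, ∃ x : α → A, ∀ ψ ∈ Γ, ψ.Realize x := by
  classical
  obtain ⟨E, hE⟩ := hQ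
  have h' : ∀ F : Finset Γ, ∃ A ∈ Q, ∃ x : α → A, ∀ ψ ∈ F, ψ.1.Realize x := fun F => by
    obtain ⟨A, hA, x, hx⟩ := h (F.map (Function.Embedding.subtype _))
      (F.map_subtype_subset)
    exact ⟨A, hA, x, fun ψ hψ => hx ψ (Finset.mem_map_of_mem _ hψ)⟩
  choose A hA x hx using h'
  have : ∀ F, Nonempty (A F) := fun F => ((hE _).1 (hA F)).1
  -- Refining `atTop` makes each `ψ ∈ Γ` hold almost everywhere, namely at every `F` containing `ψ`.
  let U : Ultrafilter (Finset Γ) := Ultrafilter.of Filter.atTop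
  refine ⟨⟨(U : Filter (Finset Γ)).Product fun F => A F, inferInstance⟩, (hE _).2 ⟨?_, ?_⟩,
    fun a => ((fun F => x F a : ∀ F, A F) : (U : Filter (Finset Γ)).Product fun F => A F),
    fun ψ hψ => ?_⟩
  · exact Ultraproduct.Product.instNonempty
  · exact fun e he => QuasiIdentity.Holds.ultraproduct (fun F => ((hE _).1 (hA F)).2 e he) U
  · refine (Ultraproduct.realize_formula_cast ψ fun a F => x F a).2 ?_
    exact Filter.Eventually.filter_mono (Ultrafilter.of_le _) (Filter.eventually_atTop.2
      ⟨{⟨ψ, hψ⟩}, fun F hF => hx F ⟨ψ, hψ⟩ (hF (Finset.mem_singleton_self _))⟩)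

end Compactness

/-! ### Positive definitions from the extension property -/

section Positive

variable {L : FirstOrder.Language.{u, v}}

/-- The subalgebra generated by a tuple. -/
def generatedBy {α : Type} {A : Type w} [L.Structure A] (x : α → A) : L.Substructure A where
  carrier := Set.range fun t : L.Term α => t.realize x
  fun_mem f y hy := by
    choose t ht using hy
    exact ⟨.func f t, congrArg (Structure.funMap f) (funext ht)⟩

theorem mem_generatedBy {α : Type} {A : Type w} [L.Structure A] (x : α → A) (i : α) :
    x i ∈ generatedBy (L := L) x :=
  ⟨.var i, rfl⟩

/-- A tuple satisfying all equations between terms that hold for `x` is the image of `x` under a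
homomorphism from the subalgebra generated by `x`. -/
theorem exists_hom_generatedBy [L.IsAlgebraic] {α : Type} {A B : Type w} [L.Structure A]
    [L.Structure B] (x : α → A) (y : α → B)
    (h : ∀ t s : L.Term α, t.realize x = s.realize x → t.realize y = s.realize y) :
    ∃ f : generatedBy (L := L) x →[L] B, ∀ i, f ⟨x i, mem_generatedBy x i⟩ = y i := by
  have hmem : ∀ a : generatedBy (L := L) x, ∃ t : L.Term α, t.realize x = a := fun a => a.2
  -- The map evaluates at `y` a chosen term for each element; `h` makes the choice immaterial.
  choose t ht using hmem
  refine ⟨⟨fun a => (t a).realize y, fun f a => ?_, fun r => isEmptyElim r⟩, fun i => ?_⟩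
  · refine h _ (.func f fun i => t (a i)) ((ht _).trans ?_)
    exact congrArg (Structure.funMap f) (funext fun i => (ht (a i)).symm)
  · exact h _ (.var i) (ht _)

variable [L.IsAlgebraic] {Q : Set (Bundled.{max u v w} L.Structure)}

/-- Under the relative congruence extension property, membership in relative principal congruences
is preserved between tuples when equations between terms are. -/
theorem HasRelCongruenceExtension.mem_relPrincipalCon (hQ : IsQuasivariety Q)
    (hext : HasRelCongruenceExtension Q) {A B : Bundled.{max u v w} L.Structure} (hA : A ∈ Q)
    (x : Fin 4 → A) (y : Fin 4 → B)
    (h : ∀ t s : L.Term (Fin 4), t.realize x = s.realize x → t.realize y = s.realize y)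
    (hx : (x 2, x 3) ∈ relPrincipalCon Q A (x 0) (x 1)) :
    (y 2, y 3) ∈ relPrincipalCon Q B (y 0) (y 1) := by
  obtain ⟨f, hf⟩ := exists_hom_generatedBy x y h
  have : Nonempty (generatedBy (L := L) x) := ⟨⟨x 0, mem_generatedBy x 0⟩⟩
  simp only [← hf]
  -- It remains to descend from `A` to the generated subalgebra, by extending each `θ` to `A`.
  refine relPrincipalCon_map hQ f fun θ hθ hab => ?_
  obtain ⟨δ, hδ, hθδ⟩ := hext A hA _ inferInstance θ hθ
  exact (hθδ _ _).2 (hx δ hδ ((hθδ _ _).1 hab))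

/-- The equations true of `x` force `φ`; otherwise compactness would give a tuple satisfying all of
them together with `¬φ`. -/
theorem exists_finConj_of_realize (hQ : IsQuasivariety Q) (hext : HasRelCongruenceExtension Q)
    {φ : L.Formula (Fin 4)} (hφ : DefinesRelPrincipalCon Q φ)
    {A : Bundled.{max u v w} L.Structure} (hA : A ∈ Q) (x : Fin 4 → A) (hx : φ.Realize x) :
    ∃ χ ∈ FinConj (atomicFormulas L (Fin 4)), χ.Realize x ∧
      ∀ B ∈ Q, ∀ y : Fin 4 → B, χ.Realize y → φ.Realize y := by
  classical
  let D : Set (L.Formula (Fin 4)) := {ψ | ψ ∈ atomicFormulas L (Fin 4) ∧ ψ.Realize x}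
  have hD : ∀ t s : L.Term (Fin 4), t.realize x = s.realize x → t.equal s ∈ D := fun t s h =>
    ⟨BoundedFormula.IsAtomic.equal _ _, Formula.realize_equal.2 h⟩
  by_contra! hcon
  obtain ⟨B, hB, y, hy⟩ := hQ.exists_realize (insert φ.not D) fun F hF => by
    obtain ⟨χ, hχ, h⟩ := FinConj.exists_realize_imp.{u, v, max u v w} (S := D)
      ⟨_, hD (.var 0) (.var 0) rfl⟩ (F.erase φ.not) fun ψ hψ => by
        rw [Finset.mem_coe, Finset.mem_erase] at hψ
        exact (hF hψ.2).resolve_left hψ.1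
    obtain ⟨B, hB, y, hy, hn⟩ := hcon χ (hχ.mono fun ψ hψ => hψ.1) (hχ.realize fun ψ hψ => hψ.2)
    refine ⟨B, hB, y, fun ψ hψ => ?_⟩
    by_cases hψφ : ψ = φ.not
    · rw [hψφ, Formula.realize_not]
      exact hn
    · exact h B y hy ψ (Finset.mem_erase.2 ⟨hψφ, hψ⟩)
  refine Formula.realize_not.1 (hy _ (Set.mem_insert _ _)) ((hφ.realize_iff hB y).2 ?_)
  refine hext.mem_relPrincipalCon hQ hA x y (fun t s h => ?_) ((hφ.realize_iff hA x).1 hx)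
  exact Formula.realize_equal.1 (hy _ (Set.mem_insert_of_mem _ (hD t s h)))

theorem exists_finDisj_of_hasRelCongruenceExtension (hQ : IsQuasivariety Q)
    (hext : HasRelCongruenceExtension Q) {φ : L.Formula (Fin 4)}
    (hφ : DefinesRelPrincipalCon Q φ) :
    ∃ χ ∈ FinDisj (FinConj (atomicFormulas L (Fin 4))), DefinesRelPrincipalCon Q χ := by
  classical
  let S : Set (L.Formula (Fin 4)) := {χ | χ ∈ FinConj (atomicFormulas L (Fin 4)) ∧
    ∀ B ∈ Q, ∀ y : Fin 4 → B, χ.Realize y → φ.Realize y}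
  -- Disjunctions must be nonempty; `z = w` always implies `φ` and serves as the default disjunct.
  have hS : S.Nonempty := by
    refine ⟨(Term.var 2).equal (Term.var 3), .of _ (BoundedFormula.IsAtomic.equal _ _),
      fun B hB y hy => (hφ.realize_iff hB y).2 fun θ _ _ => ?_⟩
    have : y 2 = y 3 := Formula.realize_equal.1 hy
    change θ.rel (y 2) (y 3)
    rw [this]
  suffices ∃ χ, FinDisj S χ ∧ ∀ B ∈ Q, ∀ y : Fin 4 → B, φ.Realize y → χ.Realize y by
    obtain ⟨χ, hχ, h⟩ := this
    refine ⟨χ, hχ.mono fun ψ hψ => hψ.1, fun A hA a b => ?_⟩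
    rw [hφ A hA a b]
    ext p
    refine ⟨h A hA _, fun hp => ?_⟩
    obtain ⟨ψ, hψ, hp⟩ := hχ.exists_realize hp
    exact hψ.2 A hA _ hp
  by_contra! hcon
  obtain ⟨B, hB, y, hy⟩ := hQ.exists_realize (insert φ (Formula.not '' S)) fun F hF => by
    obtain ⟨χ, hχ, h⟩ := FinDisj.exists_realize_of_mem.{u, v, max u v w} hS
      -- Strips the negation from members of `F`; a member that is not the negation of a formula in
      -- `S` gets a harmless default.
      ((F.image fun ψ => if hψ : ∃ χ ∈ S, χ.not = ψ then hψ.choose else hS.some)) (by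
        intro ψ hψ
        obtain ⟨ξ, -, rfl⟩ := Finset.mem_image.1 hψ
        split_ifs with hξ
        exacts [hξ.choose_spec.1, hS.some_mem])
    obtain ⟨B, hB, y, hy, hn⟩ := hcon χ hχ
    refine ⟨B, hB, y, fun ψ hψ => ?_⟩
    obtain rfl | hψS := hF hψ
    · exact hy
    · have hψS' : ∃ χ ∈ S, χ.not = ψ := hψS
      rw [← hψS'.choose_spec.2, Formula.realize_not]
      refine fun hr => hn (h B y _ (Finset.mem_image.2 ⟨ψ, hψ, dif_pos hψS'⟩) hr)
  obtain ⟨χ, hχ, hχy, hχφ⟩ :=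
    exists_finConj_of_realize hQ hext hφ hB y (hy φ (Set.mem_insert _ _))
  exact Formula.realize_not.1 (hy _ (Set.mem_insert_of_mem _ ⟨χ, ⟨hχ, hχφ⟩, rfl⟩)) hχy

end Positive

theorem mainTheorem6 {L : FirstOrder.Language.{u, v}} [L.IsAlgebraic]
    (Q : Set (Bundled.{max u v w} L.Structure)) (hQ : IsQuasivariety Q)
    (hdef : ∃ φ : L.Formula (Fin 4), DefinesRelPrincipalCon Q φ) :
    List.TFAE
      [∃ φ ∈ universalOpenFormulas L (Fin 4), DefinesRelPrincipalCon Q φ,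
       ∃ φ ∈ FinDisj (FinConj (atomicFormulas L (Fin 4))), DefinesRelPrincipalCon Q φ,
       HasRelCongruenceExtension Q] := by
  tfae_have 1 → 3 := fun ⟨_, hu, hφ⟩ => hasRelCongruenceExtension_of_isUniversal hQ hu hφ
  tfae_have 3 → 2 := fun hext => by
    obtain ⟨φ, hφ⟩ := hdef
    exact exists_finDisj_of_hasRelCongruenceExtension hQ hext hφ
  tfae_have 2 → 1 := fun ⟨φ, hφ, h⟩ =>
    ⟨φ, (FinDisj.isQF (fun _ hψ => FinConj.isQF (fun _ hξ => hξ.isQF) hψ) hφ).isUniversal, h⟩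
  tfae_finish
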